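/- All Lie algebras are finite dimensional over $\mathbb{C}$. A Lie algebra $\mathfrak g$ is \emph{sympathetic} if $Z(\mathfrak g)=0$, $[\mathfrak g,\mathfrak g]=\mathfrak g$, and every derivation of $\mathfrak g$ is inner. Let $\mathfrak g=\mathfrak g_L\ltimes\mathfrak h$, where $\mathfrak h=\operatorname{Rad}(\mathfrak g)$ and the Levi subalgebra $\mathfrak g_L$ is simple. Let $\mathfrak h=V_1\oplus\cdots\oplus V_k$ be a decomposition of $\mathfrak h$ into simple $\mathfrak g_L$-modules (for the action by the bracket), and write $s(\mathfrak g)=k$. Consider the condition (C) whenever $[V_i,V_j]\neq 0$, there is a unique $p$ with $[V_i,V_j]=V_p$. Then: 1. If $\mathfrak g$ is perfect and $s(\mathfrak g)\in\{1,2\}$, then $\mathfrak g$ is not sympathetic. 2. If (C) holds, $\mathfrak g$ is perfect, $Z(\mathfrak g)=0$ and $s(\mathfrak g)=3$, then $\mathfrak g$ is not sympathetic. More precisely, $\mathfrak g$ has a semisimple derivation $D$ that is not inner, with $D|_{\mathfrak g_L}=0$ and of one of the following two forms: either $D$ is the identity on $Z(\mathfrak h)$ and $\tfrac12\operatorname{Id}$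 on a $\mathfrak g_L$-invariant complement of $Z(\mathfrak h)$ in $\mathfrak h$; or, for a suitable ordering $V_m,V_p,V_q$ of the three summands, $D$ is $\tfrac12\operatorname{Id}$ on $V_m$, $\operatorname{Id}$ on $V_p$ and $\tfrac32\operatorname{Id}$ on $V_q$. 3. If (C) holds and $\mathfrak g$ is sympathetic and not semisimple, then $s(\mathfrak g)\geq 4$. -/

import Mathlib

/-- A Lie algebra is perfect if it equals its derived algebra. -/
def IsPerfectLie (L : Type*) [LieRing L] [LieAlgebra ℂ L] : Prop :=
  ⁅(⊤ : LieIdeal ℂ L), (⊤ : LieIdeal ℂ L)⁆ = ⊤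

/-- A derivation is inner if it is `ad x` for some `x`. -/
def IsInnerDerivation {L : Type*} [LieRing L] [LieAlgebra ℂ L]
    (D : LieDerivation ℂ L L) : Prop :=
  ∃ x : L, ∀ y : L, D y = ⁅x, y⁆

/-- A Lie algebra is sympathetic if its centre is trivial, it is perfect and all its derivations
are inner. -/
structure IsSympathetic (L : Type*) [LieRing L] [LieAlgebra ℂ L] : Prop where
  center_eq_bot : LieAlgebra.center ℂ L = ⊥
  perfect : IsPerfectLie L
  inner : ∀ D : LieDerivation ℂ L L, IsInnerDerivation D

/-- `gL` is a simple Levi subalgebra: a simple subalgebra with `L = gL ⋉ Rad L`. -/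
structure IsSimpleLevi {L : Type*} [LieRing L] [LieAlgebra ℂ L]
    (gL : LieSubalgebra ℂ L) : Prop where
  simple : LieAlgebra.IsSimple ℂ gL
  isCompl : IsCompl gL.toSubmodule (LieAlgebra.radical ℂ L).toSubmodule

/-- `Rad L` is the internal direct sum of the simple `gL`-modules `V 0, …, V (k - 1)`, where `gL`
acts by the bracket of `L`. -/
structure IsSimpleDecomposition {L : Type*} [LieRing L] [LieAlgebra ℂ L]
    (gL : LieSubalgebra ℂ L) {k : ℕ} (V : Fin k → LieSubmodule ℂ gL L) : Prop where
  irreducible : ∀ i, LieModule.IsIrreducible ℂ gL (V i)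
  independent : iSupIndep fun i => (V i).toSubmodule
  iSup_eq : ⨆ i, (V i).toSubmodule = (LieAlgebra.radical ℂ L).toSubmodule

/-- The linear span `[A, B]` of the brackets of elements of `A` with elements of `B`. -/
def bracketSpan {L : Type*} [LieRing L] [LieAlgebra ℂ L] (A B : Submodule ℂ L) : Submodule ℂ L :=
  Submodule.span ℂ {z | ∃ x ∈ A, ∃ y ∈ B, ⁅x, y⁆ = z}

/-- Every nonzero `[V i, V j]` is exactly one of the summands `V p`. -/
def BracketConvention {L : Type*} [LieRing L] [LieAlgebra ℂ L]
    {gL : LieSubalgebra ℂ L} {k : ℕ} (V : Fin k → LieSubmodule ℂ gL L) : Prop :=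
  ∀ i j, bracketSpan (V i).toSubmodule (V j).toSubmodule ≠ ⊥ →
    ∃! p, bracketSpan (V i).toSubmodule (V j).toSubmodule = (V p).toSubmodule

/-- The centre of the Lie algebra `Rad L`, as a subspace of `L`. -/
def radicalCenter (L : Type*) [LieRing L] [LieAlgebra ℂ L] : Submodule ℂ L :=
  (LieAlgebra.center ℂ (LieAlgebra.radical ℂ L)).toSubmodule.map
    (LieAlgebra.radical ℂ L).toSubmodule.subtype

/-- `D` is zero on `gL`, and on `Rad L` it is either `1` on `Z(Rad L)` and `1/2` on a
`gL`-invariant complement `W`, or it is `1/2`, `1`, `3/2` on three of the summands `V i`. -/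
def IsExplicitDerivation {L : Type*} [LieRing L] [LieAlgebra ℂ L]
    {gL : LieSubalgebra ℂ L} {k : ℕ} (V : Fin k → LieSubmodule ℂ gL L)
    (D : LieDerivation ℂ L L) : Prop :=
  (∀ x ∈ gL, D x = 0) ∧
  ((∃ W : LieSubmodule ℂ gL L,
      Disjoint W.toSubmodule (radicalCenter L) ∧
      W.toSubmodule ⊔ radicalCenter L = (LieAlgebra.radical ℂ L).toSubmodule ∧
      (∀ z ∈ radicalCenter L, D z = z) ∧ (∀ w ∈ W, D w = (1 / 2 : ℂ) • w)) ∨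
   (∃ m p q : Fin k, m ≠ p ∧ m ≠ q ∧ p ≠ q ∧
      (∀ v ∈ V m, D v = (1 / 2 : ℂ) • v) ∧ (∀ v ∈ V p, D v = v) ∧
      (∀ v ∈ V q, D v = (3 / 2 : ℂ) • v)))

/-! Write `h` for the radical. In a perfect algebra every element acts with trace zero, so by Lie's
theorem `h` kills every irreducible module. Applied to a simple quotient of an ideal `N ≠ 0`, this
gives `[h, N] < N` (`IsPerfectLie.radical_lie_lt`), so the lower central series of `h` descends
strictly to zero.

This also detects outer derivations: if `D` kills the Levi factor and is diagonal on `h ≠ 0` with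
nonzero eigenvalues, then `D = ad x` would force `x ∈ h` and hence `h ⊆ [h, h]`. It therefore
suffices to grade `h` compatibly with the Levi action, which is
`IsSimpleLevi.exists_derivation_of_grading`.

If `[h, [h, h]] = 0`, the centre of `h` and an invariant complement give the grading. This is
automatic for at most two summands, since a longer series would exceed the length of `h` as a
module. For three summands, (C) makes every term of the series a sum of some `V i`. A series of
class above two must then lose one summand at each step, and the order of loss gives the degrees
`1/2, 1, 3/2`. -/

/-! ### The action of the radical of a perfect Lie algebra -/

section Perfect

variable {L : Type*} [LieRing L] [LieAlgebra ℂ L]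

/-- On every finite-dimensional module, the elements of a perfect Lie algebra act with trace
zero. -/
lemma IsPerfectLie.trace_toEnd_eq_zero (hL : IsPerfectLie L) (M : Type*) [AddCommGroup M]
    [Module ℂ M] [LieRingModule L M] [LieModule ℂ L M] (x : L) :
    LinearMap.trace ℂ M (LieModule.toEnd ℂ L M x) = 0 := by
  have hx : x ∈ (⁅(⊤ : LieIdeal ℂ L), (⊤ : LieIdeal ℂ L)⁆ : LieIdeal ℂ L).toSubmodule := by
    rw [show ⁅(⊤ : LieIdeal ℂ L), (⊤ : LieIdeal ℂ L)⁆ = ⊤ from hL]; simp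
  rw [LieSubmodule.lieIdeal_oper_eq_linear_span'] at hx
  induction hx using Submodule.span_induction with
  | mem z hz => obtain ⟨a, -, b, -, rfl⟩ := hz; simp
  | zero => simp
  | add a b _ _ ha hb => simp [ha, hb]
  | smul t a _ ha => simp [ha]

variable [FiniteDimensional ℂ L]

/-- The radical of a perfect Lie algebra acts trivially on irreducible modules. -/
lemma IsPerfectLie.lie_eq_zero_of_isIrreducible (hL : IsPerfectLie L) (M : Type*) [AddCommGroup M]
    [Module ℂ M] [LieRingModule L M] [LieModule ℂ L M] [FiniteDimensional ℂ M]
    [LieModule.IsIrreducible ℂ L M] {x : L} (hx : x ∈ LieAlgebra.radical ℂ L) (m : M) :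
    ⁅x, m⁆ = 0 := by
  have := LieModule.nontrivial_of_isIrreducible ℂ L M
  obtain ⟨χ, hχ⟩ : ∃ χ : Module.Dual ℂ (LieAlgebra.radical ℂ L),
      Nontrivial (LieModule.weightSpace M χ) :=
    LieModule.exists_nontrivial_weightSpace_of_isSolvable ℂ (LieAlgebra.radical ℂ L) M
  -- In characteristic zero a weight space of an ideal is stable under the whole algebra, so
  -- irreducibility makes it all of `M`. Each `x` in the radical is then scalar, and its trace `χ x
  -- * dim M` vanishes.
  let N : LieSubmodule ℂ L M := LieModule.weightSpaceOfIsLieTower ℂ M χ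
  replace hχ : Nontrivial N := hχ
  replace hχ : N = ⊤ := N.eq_top_of_isIrreducible ℂ L M
  have key (m : M) : ⁅x, m⁆ = χ ⟨x, hx⟩ • m := by
    have hm : m ∈ N := hχ ▸ LieSubmodule.mem_top m
    exact (LieModule.mem_weightSpace χ m).mp hm ⟨x, hx⟩
  have hend : LieModule.toEnd ℂ L M x = χ ⟨x, hx⟩ • LinearMap.id := by
    ext m; simpa using key m
  have htr := hL.trace_toEnd_eq_zero M x
  have hrank : Module.finrank ℂ M ≠ 0 := Module.finrank_pos.ne'
  rw [hend, map_smul, LinearMap.trace_id, smul_eq_mul] at htr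
  have : χ ⟨x, hx⟩ = 0 := by
    rcases mul_eq_zero.mp htr with h | h
    · exact h
    · exact absurd (by exact_mod_cast h) hrank
  rw [key, this, zero_smul]

lemma LieModule.isIrreducible_quotient {R L M : Type*} [CommRing R] [LieRing L] [LieAlgebra R L]
    [AddCommGroup M] [Module R M] [LieRingModule L M] [LieModule R L M] {N : LieSubmodule R L M}
    (hN : IsCoatom N) : LieModule.IsIrreducible R L (M ⧸ N) := by
  have : Nontrivial (M ⧸ N) := by
    obtain ⟨m, -, hm⟩ := SetLike.exists_of_lt hN.lt_top
    exact ⟨LieSubmodule.Quotient.mk' N m, 0, fun h =>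
      hm ((LieSubmodule.Quotient.mk_eq_zero (N := N)).mp h)⟩
  refine LieModule.IsIrreducible.mk fun P hP => ?_
  let f := LieSubmodule.Quotient.mk' N
  have hle : N ≤ P.comap f := fun m hm => by
    rw [LieSubmodule.mem_comap, show f m = 0 from (LieSubmodule.Quotient.mk_eq_zero (N := N)).mpr hm]
    exact P.zero_mem
  rcases hN.le_iff.mp hle with h | h
  · rw [eq_top_iff]
    intro y _
    obtain ⟨m, rfl⟩ := LieSubmodule.Quotient.surjective_mk' N y
    exact LieSubmodule.mem_comap.mp (h ▸ LieSubmodule.mem_top m)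
  · refine absurd ((LieSubmodule.eq_bot_iff _).mpr fun y hy => ?_) hP
    obtain ⟨m, rfl⟩ := LieSubmodule.Quotient.surjective_mk' N y
    exact (LieSubmodule.Quotient.mk_eq_zero (N := N)).mpr (h ▸ LieSubmodule.mem_comap.mpr hy)

/-- In a perfect Lie algebra, bracketing a nonzero ideal with the radical gives a strictly smaller
ideal. -/
lemma IsPerfectLie.radical_lie_lt (hL : IsPerfectLie L) {N : LieIdeal ℂ L} (hN : N ≠ ⊥) :
    ⁅LieAlgebra.radical ℂ L, N⁆ < N := by
  refine lt_of_le_of_ne (LieSubmodule.lie_le_right _ _) fun h => ?_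
  have : Nontrivial N := (LieSubmodule.nontrivial_iff_ne_bot ℂ L L).mpr hN
  -- The radical kills the simple quotient of `N` by a maximal submodule `M`, so it maps `N` into
  -- `M`.
  obtain ⟨M, hM, -⟩ := (eq_top_or_exists_le_coatom (⊥ : LieSubmodule ℂ L N)).resolve_left
    bot_ne_top
  have := LieModule.isIrreducible_quotient hM
  have hle : N ≤ M.map (LieSubmodule.incl N) := by
    refine h.ge.trans ((LieSubmodule.lie_le_iff ..).mpr ?_)
    intro x hx n hn
    have hmem : ⁅x, (⟨n, hn⟩ : N)⁆ ∈ M := by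
      rw [← LieSubmodule.Quotient.mk_eq_zero (N := M), LieModuleHom.map_lie]
      exact hL.lie_eq_zero_of_isIrreducible (N ⧸ M) hx _
    exact LieSubmodule.mem_map_of_mem (f := (LieSubmodule.incl N)) hmem
  refine hM.1 (eq_top_iff.mpr fun y _ => ?_)
  obtain ⟨z, hz, hzy⟩ := (LieSubmodule.mem_map _).mp (hle y.2)
  rwa [← Subtype.ext (a1 := z) (a2 := y) hzy]

end Perfect

/-! ### Linear maps acting by scalars on subspaces -/

/-- Linear maps prescribed on two disjoint subspaces have a common extension. -/
lemma LinearMap.exists_eqOn_of_disjoint {K E F : Type*} [Field K] [AddCommGroup E] [Module K E]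
    [AddCommGroup F] [Module K F] {A B : Submodule K E} (h : Disjoint A B) (f g : E →ₗ[K] F) :
    ∃ u : E →ₗ[K] F, (∀ x ∈ A, u x = f x) ∧ ∀ x ∈ B, u x = g x := by
  obtain ⟨B', hB, hc⟩ := h.symm.exists_isCompl
  refine ⟨LinearMap.ofIsCompl hc (g.domRestrict B') (f.domRestrict A), fun x hx => ?_,
    fun x hx => ?_⟩
  · exact LinearMap.ofIsCompl_apply_right hc ⟨x, hx⟩
  · exact LinearMap.ofIsCompl_apply_left hc ⟨x, hB hx⟩

/-- A linear map that acts by additive scalars on a spanning family of subspaces is a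
derivation. -/
lemma exists_lieDerivation_of_iSup_eq_top {K L ι : Type*} [CommRing K] [LieRing L] [LieAlgebra K L]
    {U : ι → Submodule K L} (hU : ⨆ i, U i = ⊤) {c : ι → K} (D : L →ₗ[K] L)
    (hD : ∀ i, ∀ x ∈ U i, D x = c i • x)
    (hlie : ∀ i j, ∀ x ∈ U i, ∀ y ∈ U j, D ⁅x, y⁆ = (c i + c j) • ⁅x, y⁆) :
    ∃ D' : LieDerivation K L L, (D' : L →ₗ[K] L) = D := by
  refine ⟨⟨D, fun x y => ?_⟩, rfl⟩
  have hx : x ∈ ⨆ i, U i := hU ▸ Submodule.mem_top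
  have hy : y ∈ ⨆ i, U i := hU ▸ Submodule.mem_top
  induction hx using Submodule.iSup_induction' with
  | mem i x hx =>
    induction hy using Submodule.iSup_induction' with
    | mem j y hy =>
      rw [hlie i j x hx y hy, hD i x hx, hD j y hy, lie_smul, lie_smul, ← lie_skew x y, add_smul]
      module
    | zero => simp
    | add y z _ _ hy hz => rw [lie_add, map_add, hy, hz, map_add, lie_add, add_lie]; abel
  | zero => simp
  | add x z _ _ hx hz => rw [add_lie, map_add, hx, hz, map_add, lie_add, add_lie]; abel

/-- A linear map that acts by scalars on a finite spanning family of subspaces is semisimple. -/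
lemma Module.End.isSemisimple_of_iSup_eq_top {K E ι : Type*} [Field K] [AddCommGroup E]
    [Module K E] [Finite ι] {U : ι → Submodule K E} (hU : ⨆ i, U i = ⊤) {c : ι → K}
    {D : Module.End K E} (hD : ∀ i, ∀ x ∈ U i, D x = c i • x) : D.IsSemisimple := by
  classical
  have := Fintype.ofFinite ι
  -- Passing to a finset discards repeated eigenvalues, which keeps the annihilating polynomial
  -- squarefree.
  let s : Finset K := Finset.univ.image c
  refine Module.End.isSemisimple_of_squarefree_aeval_eq_zero
    (p := ∏ a ∈ s, (Polynomial.X - Polynomial.C a)) ?_ ?_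
  · exact (Polynomial.separable_prod_X_sub_C_iff' (f := id)
      |>.mpr fun x _ y _ h => h).squarefree
  · ext x
    have hx : x ∈ ⨆ i, U i := hU ▸ Submodule.mem_top
    induction hx using Submodule.iSup_induction' with
    | mem i x hx =>
      have hi : c i ∈ s := Finset.mem_image_of_mem c (Finset.mem_univ i)
      rw [← Finset.prod_erase_mul s _ hi, map_mul, Module.End.mul_apply]
      simp [hD i x hx, Algebra.algebraMap_eq_smul_one]
    | zero => simp
    | add x y _ _ hx hy => rw [map_add, hx, hy, map_add]

/-! ### Outer derivations from gradings of the radical -/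

section Grading

variable {L : Type*} [LieRing L] [LieAlgebra ℂ L]

/-- An inner derivation that vanishes on a simple Levi subalgebra comes from the radical. -/
lemma IsSimpleLevi.exists_mem_radical {gL : LieSubalgebra ℂ L} (hgL : IsSimpleLevi gL)
    {D : LieDerivation ℂ L L} (hD : IsInnerDerivation D) (h0 : ∀ x ∈ gL, D x = 0) :
    ∃ x ∈ LieAlgebra.radical ℂ L, ∀ y, D y = ⁅x, y⁆ := by
  obtain ⟨x, hx⟩ := hD
  obtain ⟨s, hs, v, hv, rfl⟩ := Submodule.mem_sup.mp
    (hgL.isCompl.sup_eq_top ▸ Submodule.mem_top : x ∈ gL.toSubmodule ⊔ _)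
  have := hgL.simple
  -- `[s, y] = -[v, y]` lies both in the Levi subalgebra and in the radical, hence is zero.
  have hcen : (⟨s, hs⟩ : gL) ∈ LieAlgebra.center ℂ gL := by
    rw [LieModule.mem_maxTrivSubmodule]
    intro y
    have h1 : ⁅s, (y : L)⁆ + ⁅v, (y : L)⁆ = 0 := by rw [← add_lie, ← hx, h0 y y.2]
    have h2 : ⁅v, (y : L)⁆ ∈ LieAlgebra.radical ℂ L := lie_mem_left ℂ L _ v y hv
    have h3 : ⁅s, (y : L)⁆ ∈ (LieAlgebra.radical ℂ L).toSubmodule := by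
      rw [eq_neg_of_add_eq_zero_left h1]; exact neg_mem h2
    have h4 : ⁅s, (y : L)⁆ = 0 :=
      Submodule.disjoint_def.mp hgL.isCompl.disjoint _ (gL.lie_mem hs y.2) h3
    apply Subtype.ext
    change ⁅(y : L), s⁆ = 0
    rw [← lie_skew, h4, neg_zero]
  rw [LieAlgebra.center_eq_bot, LieSubmodule.mem_bot] at hcen
  have hs0 : s = 0 := congrArg Subtype.val hcen
  refine ⟨v, hv, fun y => ?_⟩
  rw [hx, hs0, zero_add]

variable [FiniteDimensional ℂ L]

/-- A derivation of a perfect Lie algebra that vanishes on a simple Levi subalgebra and acts by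
nonzero scalars on subspaces spanning the nonzero radical is not inner. -/
lemma IsSimpleLevi.not_isInnerDerivation {gL : LieSubalgebra ℂ L} (hgL : IsSimpleLevi gL)
    (hL : IsPerfectLie L) (hrad : LieAlgebra.radical ℂ L ≠ ⊥) {D : LieDerivation ℂ L L}
    (h0 : ∀ x ∈ gL, D x = 0) {ι : Type*} {U : ι → Submodule ℂ L}
    (hU : ⨆ i, U i = (LieAlgebra.radical ℂ L).toSubmodule) {c : ι → ℂ} (hc : ∀ i, c i ≠ 0)
    (hD : ∀ i, ∀ x ∈ U i, D x = c i • x) : ¬ IsInnerDerivation D := by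
  intro hin
  obtain ⟨x, hx, hxD⟩ := hgL.exists_mem_radical hin h0
  refine (hL.radical_lie_lt hrad).not_ge ?_
  have hle : ⨆ i, U i ≤ (⁅LieAlgebra.radical ℂ L, LieAlgebra.radical ℂ L⁆ : LieIdeal ℂ L) := by
    refine iSup_le fun i u hu => ?_
    have hur : u ∈ LieAlgebra.radical ℂ L := by
      have := hU ▸ Submodule.mem_iSup_of_mem i hu
      exact this
    have h1 : ⁅x, u⁆ ∈ ⁅LieAlgebra.radical ℂ L, LieAlgebra.radical ℂ L⁆ :=
      LieSubmodule.lie_mem_lie hx hur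
    rw [← hxD, hD i u hu] at h1
    simpa [hc i] using Submodule.smul_mem _ (c i)⁻¹ h1
  rw [hU] at hle
  exact hle

/-- A `gL`-invariant decomposition of the radical compatible with the degrees `1, 2, 3` yields a
semisimple outer derivation. -/
lemma IsSimpleLevi.exists_derivation_of_grading {gL : LieSubalgebra ℂ L} (hgL : IsSimpleLevi gL)
    (hL : IsPerfectLie L) (hrad : LieAlgebra.radical ℂ L ≠ ⊥) {A B C : LieSubmodule ℂ gL L}
    (hAB : Disjoint A.toSubmodule B.toSubmodule)
    (hABC : Disjoint (A.toSubmodule ⊔ B.toSubmodule) C.toSubmodule)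
    (hsup : A.toSubmodule ⊔ B.toSubmodule ⊔ C.toSubmodule = (LieAlgebra.radical ℂ L).toSubmodule)
    (hAA : ∀ x ∈ A, ∀ y ∈ A, ⁅x, y⁆ ∈ B) (hAB' : ∀ x ∈ A, ∀ y ∈ B, ⁅x, y⁆ ∈ C)
    (hBB : ∀ x ∈ B, ∀ y ∈ B, ⁅x, y⁆ = 0)
    (hC : ∀ x ∈ (LieAlgebra.radical ℂ L), ∀ y ∈ C, ⁅x, y⁆ = 0) :
    ∃ D : LieDerivation ℂ L L, (∀ x ∈ gL, D x = 0) ∧ (∀ x ∈ A, D x = (1 / 2 : ℂ) • x) ∧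
      (∀ x ∈ B, D x = x) ∧ (∀ x ∈ C, D x = (3 / 2 : ℂ) • x) ∧
      Module.End.IsSemisimple (D : L →ₗ[ℂ] L) ∧ ¬ IsInnerDerivation D := by
  obtain ⟨u, huA, huB⟩ := LinearMap.exists_eqOn_of_disjoint hAB
    ((1 / 2 : ℂ) • LinearMap.id (M := L)) LinearMap.id
  obtain ⟨w, hwAB, hwC⟩ := LinearMap.exists_eqOn_of_disjoint hABC u
    ((3 / 2 : ℂ) • LinearMap.id (M := L))
  obtain ⟨D, hDg, hDr⟩ := LinearMap.exists_eqOn_of_disjoint hgL.isCompl.disjoint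
    (0 : L →ₗ[ℂ] L) w
  have hAr : A.toSubmodule ≤ (LieAlgebra.radical ℂ L).toSubmodule :=
    hsup ▸ le_sup_left.trans le_sup_left
  have hBr : B.toSubmodule ≤ (LieAlgebra.radical ℂ L).toSubmodule :=
    hsup ▸ le_sup_right.trans le_sup_left
  have hCr : C.toSubmodule ≤ (LieAlgebra.radical ℂ L).toSubmodule := hsup ▸ le_sup_right
  have hDA (x) (hx : x ∈ A) : D x = (1 / 2 : ℂ) • x := by
    rw [hDr x (hAr hx), hwAB x (Submodule.mem_sup_left hx), huA x hx]; rfl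
  have hDB (x) (hx : x ∈ B) : D x = (1 : ℂ) • x := by
    rw [hDr x (hBr hx), hwAB x (Submodule.mem_sup_right hx), huB x hx, one_smul]; rfl
  have hDC (x) (hx : x ∈ C) : D x = (3 / 2 : ℂ) • x := by
    rw [hDr x (hCr hx), hwC x hx]; rfl
  have hDg' (x) (hx : x ∈ gL) : D x = (0 : ℂ) • x := by rw [hDg x hx, zero_smul]; rfl
  -- Half-integral degrees, with the Levi factor in degree zero. Brackets that would land in degree
  -- above `3/2` vanish, and skew-symmetry leaves ten pairs to check.
  let U : Fin 4 → Submodule ℂ L := ![gL.toSubmodule, A.toSubmodule, B.toSubmodule, C.toSubmodule]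
  let c : Fin 4 → ℂ := ![0, 1 / 2, 1, 3 / 2]
  have hU : ⨆ i, U i = ⊤ := by
    rw [eq_top_iff, ← hgL.isCompl.sup_eq_top, ← hsup]
    exact sup_le (le_iSup U 0) (sup_le (sup_le (le_iSup U 1) (le_iSup U 2)) (le_iSup U 3))
  have hDU : ∀ i, ∀ x ∈ U i, D x = c i • x := by
    intro i
    fin_cases i
    exacts [hDg', hDA, hDB, hDC]
  have hsymm (i j) (h : ∀ x ∈ U i, ∀ y ∈ U j, D ⁅x, y⁆ = (c i + c j) • ⁅x, y⁆) :
      ∀ x ∈ U j, ∀ y ∈ U i, D ⁅x, y⁆ = (c j + c i) • ⁅x, y⁆ := by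
    intro x hx y hy
    rw [← lie_skew, map_neg, h y hy x hx, smul_neg, add_comm]
  have hg (P : LieSubmodule ℂ gL L) (x) (hx : x ∈ gL) (y) (hy : y ∈ P) : ⁅x, y⁆ ∈ P :=
    P.lie_mem (x := ⟨x, hx⟩) hy
  have h00 : ∀ x ∈ U 0, ∀ y ∈ U 0, D ⁅x, y⁆ = (c 0 + c 0) • ⁅x, y⁆ := fun x hx y hy => by
    rw [hDg' _ (gL.lie_mem hx hy)]; simp [c]
  have h01 : ∀ x ∈ U 0, ∀ y ∈ U 1, D ⁅x, y⁆ = (c 0 + c 1) • ⁅x, y⁆ := fun x hx y hy => by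
    rw [hDA _ (hg A x hx y hy)]; simp [c]
  have h02 : ∀ x ∈ U 0, ∀ y ∈ U 2, D ⁅x, y⁆ = (c 0 + c 2) • ⁅x, y⁆ := fun x hx y hy => by
    rw [hDB _ (hg B x hx y hy)]; simp [c]
  have h03 : ∀ x ∈ U 0, ∀ y ∈ U 3, D ⁅x, y⁆ = (c 0 + c 3) • ⁅x, y⁆ := fun x hx y hy => by
    rw [hDC _ (hg C x hx y hy)]; simp [c]
  have h11 : ∀ x ∈ U 1, ∀ y ∈ U 1, D ⁅x, y⁆ = (c 1 + c 1) • ⁅x, y⁆ := fun x hx y hy => by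
    rw [hDB _ (hAA x hx y hy)]; norm_num [c]
  have h12 : ∀ x ∈ U 1, ∀ y ∈ U 2, D ⁅x, y⁆ = (c 1 + c 2) • ⁅x, y⁆ := fun x hx y hy => by
    rw [hDC _ (hAB' x hx y hy)]; exact congrArg (· • ⁅x, y⁆)
      (by change (3 / 2 : ℂ) = 1 / 2 + 1; norm_num)
  have h13 : ∀ x ∈ U 1, ∀ y ∈ U 3, D ⁅x, y⁆ = (c 1 + c 3) • ⁅x, y⁆ := fun x hx y hy => by
    rw [hC x (hAr hx) y hy, map_zero, smul_zero]
  have h22 : ∀ x ∈ U 2, ∀ y ∈ U 2, D ⁅x, y⁆ = (c 2 + c 2) • ⁅x, y⁆ := fun x hx y hy => by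
    rw [hBB x hx y hy, map_zero, smul_zero]
  have h23 : ∀ x ∈ U 2, ∀ y ∈ U 3, D ⁅x, y⁆ = (c 2 + c 3) • ⁅x, y⁆ := fun x hx y hy => by
    rw [hC x (hBr hx) y hy, map_zero, smul_zero]
  have h33 : ∀ x ∈ U 3, ∀ y ∈ U 3, D ⁅x, y⁆ = (c 3 + c 3) • ⁅x, y⁆ := fun x hx y hy => by
    rw [hC x (hCr hx) y hy, map_zero, smul_zero]
  obtain ⟨D', rfl⟩ := exists_lieDerivation_of_iSup_eq_top hU D hDU fun i j => by
    fin_cases i <;> fin_cases j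
    exacts [h00, h01, h02, h03, hsymm 0 1 h01, h11, h12, h13, hsymm 0 2 h02, hsymm 1 2 h12, h22,
      h23, hsymm 0 3 h03, hsymm 1 3 h13, hsymm 2 3 h23, h33]
  refine ⟨D', hDg, hDA, fun x hx => (hDB x hx).trans (one_smul _ x), hDC,
    Module.End.isSemisimple_of_iSup_eq_top hU hDU, ?_⟩
  -- The shift by `succ` drops the Levi factor, the only piece with eigenvalue zero.
  refine hgL.not_isInnerDerivation hL hrad hDg (ι := Fin 3) (U := fun i => U i.succ)
    (c := fun i => c i.succ) (le_antisymm (iSup_le ?_) ?_) ?_ fun i => hDU i.succ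
  · intro i
    fin_cases i
    exacts [hAr, hBr, hCr]
  · rw [← hsup]
    exact sup_le (sup_le (le_iSup (fun i : Fin 3 => U i.succ) 0)
      (le_iSup (fun i : Fin 3 => U i.succ) 1)) (le_iSup (fun i : Fin 3 => U i.succ) 2)
  · intro i
    fin_cases i <;> norm_num [c, Fin.succ]

end Grading

/-! ### Atoms in modular lattices -/

section Lattice

variable {α : Type*} [CompleteLattice α] [IsModularLattice α]

/-- Below a finite supremum of atoms every element of a modular lattice has a relative
complement. -/
lemma exists_disjoint_sup_eq_iSup {ι : Type*} [Finite ι] {a : ι → α} (ha : ∀ i, IsAtom (a i))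
    {z : α} (hz : z ≤ ⨆ i, a i) : ∃ w, Disjoint w z ∧ w ⊔ z = ⨆ i, a i := by
  -- The complement is the supremum over a maximal set of atoms independent of `z`: an atom not
  -- below the total could still be added.
  have hfin : {s : Set ι | Disjoint (⨆ i ∈ s, a i) z}.Finite := Set.toFinite _
  obtain ⟨s, hs⟩ := hfin.exists_maximal ⟨∅, by simp⟩
  refine ⟨⨆ i ∈ s, a i, hs.prop, le_antisymm (sup_le (iSup₂_le fun i _ => le_iSup a i) hz) ?_⟩
  refine iSup_le fun i => ?_
  by_contra hi
  have hdis : Disjoint (a i) ((⨆ i ∈ s, a i) ⊔ z) := (ha i).not_le_iff_disjoint.mp hi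
  have hins : Disjoint (⨆ j ∈ insert i s, a j) z := by
    rw [iSup_insert]
    exact (hs.prop.symm.disjoint_sup_right_of_disjoint_sup_left
      (by rw [sup_comm]; exact hdis.symm)).symm.mono_left (sup_comm _ _).le
  exact hi ((le_iSup₂ (f := fun j _ => a j) i
    (hs.le_of_ge hins (Set.subset_insert i s) (Set.mem_insert i s))).trans le_sup_left)

/-- The supremum of two atoms in a modular lattice has length at most two. -/
lemma IsAtom.not_lt_of_bot_lt_of_lt_sup {a b x y : α} (ha : IsAtom a) (hb : IsAtom b)
    (hx : ⊥ < x) (hy : y < a ⊔ b) : ¬ x < y := by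
  have key {z : α} (haz : a ≤ z) (hz : z < a ⊔ b) : z = a := by
    have hbz : ¬ b ≤ z := fun h => hz.not_ge (sup_le haz h)
    have h1 : b ⊓ z = ⊥ := (hb.not_le_iff_disjoint.mp hbz).eq_bot
    calc z = (a ⊔ b) ⊓ z := (inf_eq_right.mpr hz.le).symm
      _ = a ⊔ b ⊓ z := sup_inf_assoc_of_le b haz
      _ = a := by rw [h1, sup_bot_eq]
  intro hxy
  by_cases hay : a ≤ y
  · have hya := key hay hy
    exact hx.ne' (ha.2 x (hya ▸ hxy))
  -- By modularity, joining with `a` keeps `x < y` strict. This leaves `x ⊔ a = a`, so `x` lies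
  -- below both `a` and `y`, which are disjoint.
  · have hd := ha.not_le_iff_disjoint.mp hay
    have hlt : x ⊔ a < y ⊔ a := by
      refine lt_of_le_of_ne (sup_le_sup_right hxy.le a) fun h => hxy.ne ?_
      exact eq_of_le_of_inf_le_of_sup_le hxy.le
        (by rw [inf_comm, hd.eq_bot]; exact bot_le) h.ge
    have hxa : x ⊔ a = a := key le_sup_right (hlt.trans_le (sup_le hy.le le_sup_left))
    exact hx.ne' ((hd.mono_right hxy.le).symm.eq_bot_of_le (sup_eq_right.mp hxa))

end Lattice

/-- An irreducible submodule is an atom of the lattice of submodules. -/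
lemma LieSubmodule.isAtom_of_isIrreducible {R L M : Type*} [CommRing R] [LieRing L] [LieAlgebra R L]
    [AddCommGroup M] [Module R M] [LieRingModule L M] [LieModule R L M] {N : LieSubmodule R L M}
    (hN : LieModule.IsIrreducible R L N) : IsAtom N := by
  have := LieModule.nontrivial_of_isIrreducible R L N
  refine ⟨(LieSubmodule.nontrivial_iff_ne_bot R L M).mp this, fun P hP => ?_⟩
  rcases IsSimpleOrder.eq_bot_or_eq_top (P.comap (LieSubmodule.incl N)) with h | h
  · refine (LieSubmodule.eq_bot_iff _).mpr fun x hx => ?_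
    have : (⟨x, hP.le hx⟩ : N) ∈ P.comap (LieSubmodule.incl N) := hx
    rw [h, LieSubmodule.mem_bot] at this
    exact congrArg Subtype.val this
  · refine absurd (fun x hx => ?_) hP.not_ge
    have : (⟨x, hx⟩ : N) ∈ P.comap (LieSubmodule.incl N) := h ▸ LieSubmodule.mem_top _
    exact this

/-! ### Radicals of class at most two -/

section Decomposition

variable {L : Type*} [LieRing L] [LieAlgebra ℂ L]

/-- An ideal, as a module over a subalgebra. -/
def LieIdeal.restrictSubalgebra (gL : LieSubalgebra ℂ L) (I : LieIdeal ℂ L) :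
    LieSubmodule ℂ gL L where
  toSubmodule := I.toSubmodule
  lie_mem {x _} h := I.lie_mem (x := (x : L)) h

lemma mem_radicalCenter {x : L} : x ∈ radicalCenter L ↔
    x ∈ LieAlgebra.radical ℂ L ∧ ∀ y ∈ LieAlgebra.radical ℂ L, ⁅y, x⁆ = 0 := by
  constructor
  · rintro ⟨z, hz, rfl⟩
    refine ⟨z.2, fun y hy => ?_⟩
    exact congrArg Subtype.val ((LieModule.mem_maxTrivSubmodule _ _ _ z).mp hz ⟨y, hy⟩)
  · rintro ⟨hx, h⟩
    refine ⟨⟨x, hx⟩, (LieModule.mem_maxTrivSubmodule _ _ _ _).mpr fun y => ?_, rfl⟩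
    exact Subtype.ext (h y y.2)

/-- The centre of the radical, as a module over a subalgebra. -/
def radicalCenterSubmodule (gL : LieSubalgebra ℂ L) : LieSubmodule ℂ gL L where
  toSubmodule := radicalCenter L
  lie_mem {x z} hz := by
    have hz' := mem_radicalCenter.mp hz
    refine mem_radicalCenter.mpr ⟨(LieAlgebra.radical ℂ L).lie_mem (x := (x : L)) hz'.1,
      fun y hy => ?_⟩
    change ⁅y, ⁅(x : L), z⁆⁆ = 0
    rw [leibniz_lie, hz'.2 y hy, lie_zero, add_zero]
    exact hz'.2 _ (lie_mem_left ℂ L _ y x hy)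

variable {gL : LieSubalgebra ℂ L} {k : ℕ} {V : Fin k → LieSubmodule ℂ gL L}

lemma IsSimpleDecomposition.isAtom (hV : IsSimpleDecomposition gL V) (i : Fin k) : IsAtom (V i) :=
  LieSubmodule.isAtom_of_isIrreducible (hV.irreducible i)

lemma IsSimpleDecomposition.iSup_eq' (hV : IsSimpleDecomposition gL V) :
    ⨆ i, V i = (LieAlgebra.radical ℂ L).restrictSubalgebra gL := by
  rw [← LieSubmodule.toSubmodule_inj, LieSubmodule.iSup_toSubmodule, hV.iSup_eq]
  rfl

lemma IsSimpleDecomposition.radical_ne_bot (hV : IsSimpleDecomposition gL V) (i : Fin k) :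
    LieAlgebra.radical ℂ L ≠ ⊥ := by
  intro h
  have hle : (V i).toSubmodule ≤ (LieAlgebra.radical ℂ L).toSubmodule :=
    hV.iSup_eq ▸ le_iSup (fun i => (V i).toSubmodule) i
  rw [h] at hle
  exact (hV.isAtom i).1 (le_bot_iff.mp hle)

variable [FiniteDimensional ℂ L]

/-- If the radical is nilpotent of class at most two, then `1` on its centre and `1/2` on an
invariant complement extends to an outer derivation. -/
lemma IsSimpleDecomposition.exists_derivation_of_lie_lie_eq_bot (hgL : IsSimpleLevi gL)
    (hV : IsSimpleDecomposition gL V) (hL : IsPerfectLie L) (hrad : LieAlgebra.radical ℂ L ≠ ⊥)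
    (h : ⁅LieAlgebra.radical ℂ L, ⁅LieAlgebra.radical ℂ L, LieAlgebra.radical ℂ L⁆⁆ = ⊥) :
    ∃ D : LieDerivation ℂ L L, IsExplicitDerivation V D ∧
      Module.End.IsSemisimple (D : L →ₗ[ℂ] L) ∧ ¬ IsInnerDerivation D := by
  obtain ⟨W, hd, hs⟩ := exists_disjoint_sup_eq_iSup hV.isAtom
    (z := radicalCenterSubmodule gL) (hV.iSup_eq' ▸ fun x hx => (mem_radicalCenter.mp hx).1)
  rw [hV.iSup_eq'] at hs
  have hd' : Disjoint W.toSubmodule (radicalCenter L) :=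
    (LieSubmodule.disjoint_toSubmodule ..).mpr hd
  have hs' : W.toSubmodule ⊔ radicalCenter L = (LieAlgebra.radical ℂ L).toSubmodule := by
    have := congrArg LieSubmodule.toSubmodule hs
    rwa [LieSubmodule.sup_toSubmodule] at this
  have hWr (x) (hx : x ∈ W) : x ∈ LieAlgebra.radical ℂ L := by
    have : W.toSubmodule ≤ (LieAlgebra.radical ℂ L).toSubmodule := hs' ▸ le_sup_left
    exact this hx
  -- Degree `3/2` is empty; vanishing triple brackets put `[W, W]` in the centre of the radical.
  obtain ⟨D, h0, hA, hB, -, hss, hin⟩ := hgL.exists_derivation_of_grading hL hrad (A := W)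
    (B := radicalCenterSubmodule gL) (C := ⊥) hd' (by simp)
    (by rw [LieSubmodule.bot_toSubmodule, sup_bot_eq]; exact hs')
    (fun x hx y hy => mem_radicalCenter.mpr ⟨lie_mem_left ℂ L _ x y (hWr x hx), fun z hz => by
      have : ⁅z, ⁅x, y⁆⁆ ∈
          ⁅LieAlgebra.radical ℂ L, ⁅LieAlgebra.radical ℂ L, LieAlgebra.radical ℂ L⁆⁆ :=
        LieSubmodule.lie_mem_lie hz (LieSubmodule.lie_mem_lie (hWr x hx) (hWr y hy))
      rwa [h, LieSubmodule.mem_bot] at this⟩)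
    (fun x hx y hy => by rw [(mem_radicalCenter.mp hy).2 x (hWr x hx)]; exact zero_mem _)
    (fun x hx y hy => (mem_radicalCenter.mp hy).2 x (mem_radicalCenter.mp hx).1)
    (fun x _ y hy => by rw [(LieSubmodule.mem_bot y).mp hy, lie_zero])
  exact ⟨D, ⟨h0, Or.inl ⟨W, hd', hs', hB, hA⟩⟩, hss, hin⟩

/-- A nonzero `[h, [h, h]]` would give a strict chain `0 < [h, [h, h]] < [h, h] < h`, too long for a
join of two atoms. -/
lemma IsSimpleDecomposition.not_isSympathetic_of_le_two (hgL : IsSimpleLevi gL)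
    (hV : IsSimpleDecomposition gL V) (hL : IsPerfectLie L) (hk : k = 1 ∨ k = 2) :
    ¬ IsSympathetic L := by
  intro hsym
  have i0 : Fin k := ⟨0, by omega⟩
  have hrad := hV.radical_ne_bot i0
  have hsup : ∃ i j, V i ⊔ V j = (LieAlgebra.radical ℂ L).restrictSubalgebra gL := by
    rw [← hV.iSup_eq']
    rcases hk with rfl | rfl
    -- The two atoms need not be distinct, so a single summand is used twice.
    · exact ⟨0, 0, le_antisymm (sup_le (le_iSup V 0) (le_iSup V 0))
        (iSup_le fun i => by fin_cases i; exact le_sup_left)⟩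
    · refine ⟨0, 1, le_antisymm (sup_le (le_iSup V 0) (le_iSup V 1)) (iSup_le fun i => ?_)⟩
      fin_cases i
      exacts [le_sup_left, le_sup_right]
  obtain ⟨i, j, hij⟩ := hsup
  have h2 : ⁅LieAlgebra.radical ℂ L, ⁅LieAlgebra.radical ℂ L, LieAlgebra.radical ℂ L⁆⁆ = ⊥ := by
    by_contra h3
    have h2 : ⁅LieAlgebra.radical ℂ L, LieAlgebra.radical ℂ L⁆ ≠ ⊥ := fun h => h3 (by
      rw [h, LieSubmodule.lie_bot])
    have hmono {I J : LieIdeal ℂ L} (h : I < J) :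
        I.restrictSubalgebra gL < J.restrictSubalgebra gL := h
    refine (hV.isAtom i).not_lt_of_bot_lt_of_lt_sup (hV.isAtom j) ?_ ?_
      (hmono (hL.radical_lie_lt h2))
    · exact hmono (I := ⊥) (bot_lt_iff_ne_bot.mpr h3)
    · rw [hij]
      exact hmono (hL.radical_lie_lt hrad)
  obtain ⟨D, -, -, hD⟩ := hV.exists_derivation_of_lie_lie_eq_bot hgL hL hrad h2
  exact hD (hsym.inner D)

end Decomposition

/-! ### Three summands under condition (C) -/

section Convention

variable {L : Type*} [LieRing L] [LieAlgebra ℂ L]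

lemma bracketSpan_eq_map₂ (A B : Submodule ℂ L) :
    bracketSpan A B = Submodule.map₂ (LieModule.toEnd ℂ L L : L →ₗ[ℂ] Module.End ℂ L) A B := by
  rw [Submodule.map₂_eq_span_image2]
  rfl

lemma bracketSpan_toSubmodule (I J : LieIdeal ℂ L) :
    bracketSpan I.toSubmodule J.toSubmodule = (⁅I, J⁆ : LieIdeal ℂ L).toSubmodule :=
  (LieSubmodule.lieIdeal_oper_eq_linear_span' J I).symm

lemma lie_mem_bracketSpan {A B : Submodule ℂ L} {x y : L} (hx : x ∈ A) (hy : y ∈ B) :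
    ⁅x, y⁆ ∈ bracketSpan A B :=
  Submodule.subset_span ⟨x, hx, y, hy, rfl⟩

lemma bracketSpan_comm (A B : Submodule ℂ L) : bracketSpan A B = bracketSpan B A := by
  have key (A B : Submodule ℂ L) : bracketSpan A B ≤ bracketSpan B A := by
    refine Submodule.span_le.mpr ?_
    rintro _ ⟨x, hx, y, hy, rfl⟩
    rw [← lie_skew]
    exact neg_mem (lie_mem_bracketSpan hy hx)
  exact le_antisymm (key A B) (key B A)

variable {gL : LieSubalgebra ℂ L} {k : ℕ} {V : Fin k → LieSubmodule ℂ gL L}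

open Classical in
/-- The indices of the summands occurring in the bracket of the radical with the sum of the
summands indexed by `S`. -/
noncomputable def lieIndices (V : Fin k → LieSubmodule ℂ gL L) (S : Finset (Fin k)) :
    Finset (Fin k) :=
  {p | ∃ i, ∃ j ∈ S, bracketSpan (V i).toSubmodule (V j).toSubmodule = (V p).toSubmodule}

lemma mem_lieIndices {S : Finset (Fin k)} {p : Fin k} : p ∈ lieIndices V S ↔
    ∃ i, ∃ j ∈ S, bracketSpan (V i).toSubmodule (V j).toSubmodule = (V p).toSubmodule := by
  simp [lieIndices]

/-- A bracket of two summands is zero or is a summand. -/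
lemma BracketConvention.bracketSpan_eq_bot_or (hC : BracketConvention V) (i : Fin k)
    {S : Finset (Fin k)} {j : Fin k} (hj : j ∈ S) :
    bracketSpan (V i).toSubmodule (V j).toSubmodule = ⊥ ∨ ∃ p ∈ lieIndices V S,
      bracketSpan (V i).toSubmodule (V j).toSubmodule = (V p).toSubmodule := by
  refine or_iff_not_imp_left.mpr fun h => ?_
  obtain ⟨p, hp, -⟩ := hC i j h
  exact ⟨p, mem_lieIndices.mpr ⟨i, j, hj, hp⟩, hp⟩

/-- The bracket distributes over sums, and (C) makes each term zero or one summand. The lower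
central series thus becomes a chain of index sets. -/
lemma BracketConvention.bracketSpan_biSup (hC : BracketConvention V)
    (hV : IsSimpleDecomposition gL V) (S : Finset (Fin k)) :
    bracketSpan (LieAlgebra.radical ℂ L).toSubmodule (⨆ j ∈ S, (V j).toSubmodule) =
      ⨆ p ∈ lieIndices V S, (V p).toSubmodule := by
  rw [← hV.iSup_eq, bracketSpan_eq_map₂, Submodule.map₂_iSup_left]
  simp_rw [Submodule.map₂_iSup_right, ← bracketSpan_eq_map₂]
  refine le_antisymm (iSup_le fun i => iSup₂_le fun j hj => ?_) (iSup₂_le fun p hp => ?_)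
  · rcases hC.bracketSpan_eq_bot_or i hj with h | ⟨p, hp, h⟩
    · rw [h]; exact bot_le
    · rw [h]; exact le_iSup₂ (f := fun p _ => (V p).toSubmodule) p hp
  · obtain ⟨i, j, hj, h⟩ := mem_lieIndices.mp hp
    rw [← h]
    exact le_iSup_of_le i
      (le_iSup₂ (f := fun j _ => bracketSpan (V i).toSubmodule (V j).toSubmodule) j hj)

lemma IsSimpleDecomposition.subset_of_biSup_le (hV : IsSimpleDecomposition gL V)
    {S T : Finset (Fin k)}
    (h : ⨆ j ∈ T, (V j).toSubmodule ≤ ⨆ j ∈ S, (V j).toSubmodule) : T ⊆ S := by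
  intro p hp
  by_contra hpS
  have hd := hV.independent.disjoint_biSup (y := (S : Set (Fin k))) (x := p) hpS
  have hle := (le_iSup₂ (f := fun p _ => (V p).toSubmodule) p hp).trans h
  exact (hV.isAtom p).1 ((LieSubmodule.toSubmodule_eq_bot _).mp (hd.eq_bot_of_le hle))

variable [FiniteDimensional ℂ L]

/-- Bracketing an ideal with the radical removes at least one of its summands. -/
lemma BracketConvention.lieIndices_ssubset (hC : BracketConvention V)
    (hV : IsSimpleDecomposition gL V) (hL : IsPerfectLie L) {I : LieIdeal ℂ L}
    {S : Finset (Fin k)} (hI : I.toSubmodule = ⨆ j ∈ S, (V j).toSubmodule) (hS : I ≠ ⊥) :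
    lieIndices V S ⊂ S := by
  have heq : (⁅LieAlgebra.radical ℂ L, I⁆ : LieIdeal ℂ L).toSubmodule =
      ⨆ p ∈ lieIndices V S, (V p).toSubmodule := by
    rw [← bracketSpan_toSubmodule, hI, hC.bracketSpan_biSup hV]
  have hlt := hL.radical_lie_lt hS
  refine Finset.ssubset_iff_subset_ne.mpr ⟨hV.subset_of_biSup_le ?_, fun h => hlt.ne ?_⟩
  · rw [← heq, ← hI]; exact hlt.le
  · rw [← LieSubmodule.toSubmodule_inj, heq, h, hI]

/-- The cardinalities must be 3, 2, 1; `m` is lost first, then `p`, and `q` survives. -/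
lemma Fin.exists_of_ssubset_chain : ∀ S₁ S₂ : Finset (Fin 3), S₁ ⊂ Finset.univ → S₂ ⊂ S₁ →
    S₂ ≠ ∅ → ∃ m p q : Fin 3, m ≠ p ∧ m ≠ q ∧ p ≠ q ∧ S₁ = {p, q} ∧ S₂ = {q} ∧
      ∀ i, i = m ∨ i = p ∨ i = q := by
  decide

/-- For three summands, a radical of class greater than two has an outer derivation with
eigenvalues `1/2`, `1` and `3/2` on the summands. -/
lemma BracketConvention.exists_derivation_of_lie_lie_ne_bot {V : Fin 3 → LieSubmodule ℂ gL L}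
    (hgL : IsSimpleLevi gL) (hC : BracketConvention V) (hV : IsSimpleDecomposition gL V)
    (hL : IsPerfectLie L)
    (h : ⁅LieAlgebra.radical ℂ L, ⁅LieAlgebra.radical ℂ L, LieAlgebra.radical ℂ L⁆⁆ ≠ ⊥) :
    ∃ D : LieDerivation ℂ L L, IsExplicitDerivation V D ∧
      Module.End.IsSemisimple (D : L →ₗ[ℂ] L) ∧ ¬ IsInnerDerivation D := by
  have hrad := hV.radical_ne_bot 0
  have e0 : (LieAlgebra.radical ℂ L).toSubmodule =
      ⨆ j ∈ (Finset.univ : Finset (Fin 3)), (V j).toSubmodule := by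
    simp [hV.iSup_eq]
  have e1 : (⁅LieAlgebra.radical ℂ L, LieAlgebra.radical ℂ L⁆ : LieIdeal ℂ L).toSubmodule =
      ⨆ j ∈ lieIndices V Finset.univ, (V j).toSubmodule := by
    rw [← bracketSpan_toSubmodule, ← hC.bracketSpan_biSup hV, ← e0]
  have e2 : (⁅LieAlgebra.radical ℂ L, ⁅LieAlgebra.radical ℂ L, LieAlgebra.radical ℂ L⁆⁆ :
      LieIdeal ℂ L).toSubmodule =
      ⨆ j ∈ lieIndices V (lieIndices V Finset.univ), (V j).toSubmodule := by
    rw [← bracketSpan_toSubmodule, ← hC.bracketSpan_biSup hV, ← e1]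
  have hlt := hC.lieIndices_ssubset hV hL e2 h
  obtain ⟨m, p, q, hmp, hmq, hpq, h1, h2, hall⟩ := Fin.exists_of_ssubset_chain _ _
    (hC.lieIndices_ssubset hV hL e0 hrad)
    (hC.lieIndices_ssubset hV hL e1 fun h' => h (by rw [h', LieSubmodule.lie_bot]))
    ((Finset.empty_subset _).trans_ssubset hlt).ne'
  -- The next index set is a proper subset of `{q}`, hence empty: `V q` commutes with the radical.
  have h3 := hlt
  rw [h2, Finset.ssubset_singleton_iff, ← h2] at h3
  have hVr (i) : (V i).toSubmodule ≤ (LieAlgebra.radical ℂ L).toSubmodule :=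
    hV.iSup_eq ▸ le_iSup (fun i => (V i).toSubmodule) i
  have hinj {i j} (hij : (V i).toSubmodule = (V j).toSubmodule) : i = j := by
    have := hV.subset_of_biSup_le (S := {j}) (T := {i}) (by simp [hij])
    simpa using this
  have hiq (i) : bracketSpan (V i).toSubmodule (V q).toSubmodule = ⊥ := by
    rcases hC.bracketSpan_eq_bot_or i (S := lieIndices V (lieIndices V Finset.univ)) (j := q)
      (by simp [h2]) with h | ⟨r, hr, -⟩
    · exact h
    · simp [h3] at hr
  have hip (i) : bracketSpan (V i).toSubmodule (V p).toSubmodule ≤ (V q).toSubmodule := by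
    rcases hC.bracketSpan_eq_bot_or i (S := lieIndices V Finset.univ) (j := p)
      (by simp [h1]) with h | ⟨r, hr, h⟩
    · rw [h]; exact bot_le
    · rw [h2, Finset.mem_singleton] at hr
      rw [h, hr]
  -- Some bracket of summands equals `V p`. Those involving `V q` vanish and those involving `V p`
  -- lie in `V q`, so only `[V m, V m]` remains.
  have hmm : bracketSpan (V m).toSubmodule (V m).toSubmodule = (V p).toSubmodule := by
    have hp : p ∈ lieIndices V Finset.univ := by simp [h1]
    obtain ⟨i, j, -, hij⟩ := mem_lieIndices.mp hp
    have hne (i) : bracketSpan (V i).toSubmodule (V p).toSubmodule ≠ (V p).toSubmodule ∧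
        bracketSpan (V i).toSubmodule (V q).toSubmodule ≠ (V p).toSubmodule := by
      refine ⟨fun h => hpq ?_, fun h => (hV.isAtom p).1 ?_⟩
      · have hle : (V p).toSubmodule ≤ (V q).toSubmodule := h ▸ hip i
        simpa using hV.subset_of_biSup_le (S := {q}) (T := {p}) (by simpa using hle)
      · rw [hiq i] at h
        exact (LieSubmodule.toSubmodule_eq_bot _).mp h.symm
    rcases hall j with rfl | rfl | rfl
    · rw [bracketSpan_comm] at hij
      rcases hall i with rfl | rfl | rfl
      · exact hij
      · exact absurd hij (hne _).1
      · exact absurd hij (hne _).2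
    · exact absurd hij (hne i).1
    · exact absurd hij (hne i).2
  have hq : ∀ x ∈ LieAlgebra.radical ℂ L, ∀ y ∈ V q, ⁅x, y⁆ = 0 := by
    intro x hx y hy
    have hb : bracketSpan (LieAlgebra.radical ℂ L).toSubmodule (V q).toSubmodule = ⊥ := by
      have := hC.bracketSpan_biSup hV (lieIndices V (lieIndices V Finset.univ))
      rwa [h3, h2, Finset.iSup_singleton, iSup₂_eq_bot.mpr (by simp)] at this
    have := lie_mem_bracketSpan (A := (LieAlgebra.radical ℂ L).toSubmodule) hx hy
    rwa [hb, Submodule.mem_bot] at this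
  -- Write `x` through brackets `[a, b]` from `V m`; by Jacobi, `[[a, b], y]` lies in `[V m, V q] =
  -- 0`.
  have hpp : ∀ x ∈ V p, ∀ y ∈ V p, ⁅x, y⁆ = 0 := by
    intro x hx y hy
    have hx' : x ∈ bracketSpan (V m).toSubmodule (V m).toSubmodule := hmm ▸ hx
    induction hx' using Submodule.span_induction with
    | mem z hz =>
      obtain ⟨a, ha, b, hb, rfl⟩ := hz
      rw [lie_lie, hq a (hVr m ha) _ (hip m (lie_mem_bracketSpan hb hy)),
        hq b (hVr m hb) _ (hip m (lie_mem_bracketSpan ha hy)), sub_zero]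
    | zero => exact zero_lie y
    | add a b ha hb iha ihb =>
      rw [add_lie, iha (hmm.le ha), ihb (hmm.le hb), add_zero]
    | smul t a ha iha => rw [smul_lie, iha (hmm.le ha), smul_zero]
  obtain ⟨D, h0, hA, hB, hC', hss, hin⟩ := hgL.exists_derivation_of_grading hL hrad (A := V m)
    (B := V p) (C := V q) (hV.independent.pairwiseDisjoint hmp) (by
      have := hV.independent.disjoint_biSup (x := q) (y := {m, p}) (by simp [hmq.symm, hpq.symm])
      rw [iSup_pair] at this
      exact this.symm)
    (by
      rw [← hV.iSup_eq]
      refine le_antisymm (sup_le (sup_le (le_iSup (fun i => (V i).toSubmodule) m)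
        (le_iSup (fun i => (V i).toSubmodule) p)) (le_iSup (fun i => (V i).toSubmodule) q))
        (iSup_le fun i => ?_)
      rcases hall i with rfl | rfl | rfl
      exacts [le_sup_left.trans le_sup_left, le_sup_right.trans le_sup_left, le_sup_right])
    (fun x hx y hy => hmm.le (lie_mem_bracketSpan hx hy))
    (fun x hx y hy => hip m (lie_mem_bracketSpan hx hy)) hpp hq
  exact ⟨D, ⟨h0, Or.inr ⟨m, p, q, hmp, hmq, hpq, hA, hB, hC'⟩⟩, hss, hin⟩

lemma BracketConvention.exists_derivation {V : Fin 3 → LieSubmodule ℂ gL L}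
    (hgL : IsSimpleLevi gL) (hC : BracketConvention V) (hV : IsSimpleDecomposition gL V)
    (hL : IsPerfectLie L) :
    ∃ D : LieDerivation ℂ L L, IsExplicitDerivation V D ∧
      Module.End.IsSemisimple (D : L →ₗ[ℂ] L) ∧ ¬ IsInnerDerivation D := by
  by_cases h : ⁅LieAlgebra.radical ℂ L, ⁅LieAlgebra.radical ℂ L, LieAlgebra.radical ℂ L⁆⁆ = ⊥
  · exact hV.exists_derivation_of_lie_lie_eq_bot hgL hL (hV.radical_ne_bot 0) h
  · exact hC.exists_derivation_of_lie_lie_ne_bot hgL hV hL h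

end Convention

/-- A Lie algebra with a simple Levi subalgebra and zero radical is simple. -/
lemma IsSimpleLevi.isSimple_of_radical_eq_bot {L : Type*} [LieRing L] [LieAlgebra ℂ L]
    {gL : LieSubalgebra ℂ L} (hgL : IsSimpleLevi gL) (h : LieAlgebra.radical ℂ L = ⊥) :
    LieAlgebra.IsSimple ℂ L := by
  have htop (x : L) : x ∈ gL := by
    have hs := hgL.isCompl.sup_eq_top
    rw [h, LieSubmodule.bot_toSubmodule, sup_bot_eq] at hs
    exact (hs ▸ Submodule.mem_top : x ∈ gL.toSubmodule)
  have hsimple := hgL.simple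
  refine ⟨fun I => ?_, fun hab => hsimple.non_abelian ⟨fun x y => Subtype.ext (hab.trivial x y)⟩⟩
  rcases hsimple.eq_bot_or_eq_top (I.comap gL.incl) with h | h
  · refine Or.inl ((LieSubmodule.eq_bot_iff I).mpr fun x hx => ?_)
    have : (⟨x, htop x⟩ : gL) ∈ I.comap gL.incl := LieIdeal.mem_comap.mpr hx
    rw [h, LieSubmodule.mem_bot] at this
    exact congrArg Subtype.val this
  · refine Or.inr (eq_top_iff.mpr fun x _ => ?_)
    have : (⟨x, htop x⟩ : gL) ∈ I.comap gL.incl := h ▸ LieSubmodule.mem_top _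
    exact LieIdeal.mem_comap.mp this

theorem mainTheorem5 {L : Type*} [LieRing L] [LieAlgebra ℂ L] [FiniteDimensional ℂ L]
    (gL : LieSubalgebra ℂ L) (hgL : IsSimpleLevi gL)
    {k : ℕ} (V : Fin k → LieSubmodule ℂ gL L) (hV : IsSimpleDecomposition gL V) :
    (IsPerfectLie L → k = 1 ∨ k = 2 → ¬ IsSympathetic L) ∧
    (BracketConvention V → IsPerfectLie L → LieAlgebra.center ℂ L = ⊥ → k = 3 →
      ¬ IsSympathetic L ∧
      ∃ D : LieDerivation ℂ L L, IsExplicitDerivation V D ∧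
        Module.End.IsSemisimple (D : L →ₗ[ℂ] L) ∧ ¬ IsInnerDerivation D) ∧
    (BracketConvention V → IsSympathetic L → ¬ LieAlgebra.IsSemisimple ℂ L → 4 ≤ k) := by
  refine ⟨hV.not_isSympathetic_of_le_two hgL, ?_, ?_⟩
  · rintro hC hL - rfl
    have hex := hC.exists_derivation hgL hV hL
    exact ⟨fun hs => hex.elim fun D hD => hD.2.2 (hs.inner D), hex⟩
  · intro hC hs hns
    by_contra hk
    have hk' : k = 0 ∨ (k = 1 ∨ k = 2) ∨ k = 3 := by omega
    rcases hk' with rfl | hk | rfl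
    -- Without summands the algebra is its simple Levi factor, hence semisimple.
    · have hrad : LieAlgebra.radical ℂ L = ⊥ := by
        rw [← LieSubmodule.toSubmodule_inj, ← hV.iSup_eq, iSup_of_empty]
        rfl
      have := hgL.isSimple_of_radical_eq_bot hrad
      exact hns inferInstance
    · exact hV.not_isSympathetic_of_le_two hgL hs.perfect hk hs
    · obtain ⟨D, -, -, hD⟩ := hC.exists_derivation hgL hV hs.perfect
      exact hD (hs.inner D)
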